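/- Let $G$ be a real Lie group. Its tangent bundle $TG$ is a group, with product the tangent map of the multiplication $G\times G\to G$ read on $TG\times TG\cong T(G\times G)$. For a finite-dimensional real vector space $V$, the tangent bundle $TV$ is a real vector space of dimension $2\dim V$ with the sum $X\oplus Y=(T\tau_y)X+(T\tau_x)Y$ for $X\in T_xV$, $Y\in T_yV$ and the scalar multiplication $\lambda\bullet X=(T\sigma_\lambda)X$, where $\tau_a$ is the translation by $a$ and $\sigma_\lambda$ the multiplication by $\lambda$. For a basis $\alpha_1,\dots,\alpha_n$ of $V$ with coordinate functions $x_1,\dots,x_n$, let $\psi:TV\to V\times\mathbb R^n$ be the linear isomorphism $\sum_i v_i\,\partial/\partial x_i|_p\mapsto(p,(v_1,\dots,v_n))$, and consider the basis $\psi^{-1}(\alpha_1,0),\dots,\psi^{-1}(\alpha_n,0),\psi^{-1}(0,e_1),\dots,\psi^{-1}(0,e_n)$ of $TV$. Let $Z:\mathrm{Aut}(V)\to GL(n,\mathbb R)$ and $\breve Z:\mathrm{Aut}(TV)\to GL(2n,\mathbb R)$ be the isomorphisms that take an automorphism to its matrix in these bases, and let $$J_n:T\,GL(n,\mathbb R)\to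 GL(2n,\mathbb R),\qquad J_n(Y)=\begin{pmatrix}a&0\\ Ba&a\end{pmatrix}\quad\text{for } Y\in T_aGL(n,\mathbb R),\ B=(TR_{a^{-1}})Y\in \mathrm{Lie}(GL(n,\mathbb R)),$$ where $R_c(y)=yc$. The prolongation of a finite-dimensional real representation $\Phi:G\to\mathrm{Aut}(V)$ (a smooth group homomorphism) is the group homomorphism $$\widetilde\Phi=\breve Z^{-1}\circ J_n\circ TZ\circ T\Phi:\ TG\to\mathrm{Aut}(TV).$$ Let $\Phi_1:G\to\mathrm{Aut}(V_1)$ and $\Phi_2:G\to\mathrm{Aut}(V_2)$ be finite-dimensional real representations of $G$. Then, under the linear isomorphism $(T\mathrm{pr}_1,T\mathrm{pr}_2):T(V_1\oplus V_2)\to TV_1\oplus TV_2$, $$\widetilde{\Phi_1\oplus\Phi_2}=\widetilde{\Phi_1}\oplus\widetilde{\Phi_2}$$ as homomorphisms $TG\to\mathrm{Aut}(TV_1\oplus TV_2)$, for every choice of the bases of $V_1$, $V_2$ and $V_1\oplus V_2$ used to define the three prolongations. -/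

import Mathlib

open scoped Manifold ContDiff

noncomputable section

namespace LieProlongation

/-! ### The tangent group `TG` of a Lie group `G` -/

section TangentGroup

variable {E : Type*} [NormedAddCommGroup E] [NormedSpace ℝ E] {H : Type*} [TopologicalSpace H]
  {I : ModelWithCorners ℝ E H} {G : Type*} [TopologicalSpace G] [ChartedSpace H G] [Group G]

/-- The product on `TG`: the tangent map of `G × G → G`, read on `TG × TG = T(G × G)`. -/
instance tangentMul : Mul (TangentBundle I G) where
  mul X Y := tangentMap (I.prod I) I (fun p : G × G => p.1 * p.2)
    ((equivTangentBundleProd I G I G).symm (X, Y))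

/-- The unit of `TG`: the zero vector at the unit of `G`. -/
instance tangentOne : One (TangentBundle I G) where
  one := ⟨1, (0 : TangentSpace I (1 : G))⟩

/-- The inverse on `TG`: the tangent map of the inverse of `G`. -/
instance tangentInv : Inv (TangentBundle I G) where
  inv X := tangentMap I I (fun a : G => a⁻¹) X

variable {E' : Type*} [NormedAddCommGroup E'] [NormedSpace ℝ E'] {H' : Type*} [TopologicalSpace H']
  {I' : ModelWithCorners ℝ E' H'} {M : Type*} [TopologicalSpace M] [ChartedSpace H' M]

theorem tangentMap_const_one (p : TangentBundle I' M) :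
    tangentMap I' I (fun _ : M => (1 : G)) p = 1 := by
  simp only [tangentMap, mfderiv_const]
  rfl

variable [LieGroup I ∞ G]

/-- The tangent map of a pointwise product is the product in `TG` of the tangent maps. -/
theorem tangentMap_mul {f g : M → G} {p : TangentBundle I' M}
    (hf : MDifferentiableAt I' I f p.1) (hg : MDifferentiableAt I' I g p.1) :
    tangentMap I' I (fun x => f x * g x) p = tangentMap I' I f p * tangentMap I' I g p := by
  have hm : MDifferentiableAt (I.prod I) I (fun q : G × G => q.1 * q.2) (f p.1, g p.1) :=
    ((contMDiff_mul I ∞ (G := G)).mdifferentiable (by simp)) _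
  have h := tangentMap_comp_at (I := I') (I' := I.prod I) (I'' := I)
    (g := fun q : G × G => q.1 * q.2) (f := fun x => (f x, g x)) p hm (hf.prodMk hg)
  refine h.trans ?_
  change _ = tangentMap (I.prod I) I (fun p : G × G => p.1 * p.2)
    ((equivTangentBundleProd I G I G).symm (tangentMap I' I f p, tangentMap I' I g p))
  congr 1
  simp only [tangentMap, mfderiv_prodMk hf hg]
  rfl

/-- `T` of the first projection, on a pair of tangent vectors. -/
theorem tangentMap_fst_pair {N : Type*} [TopologicalSpace N] [ChartedSpace H N]
    (X : TangentBundle I' M) (Y : TangentBundle I N) :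
    tangentMap (I'.prod I) I' Prod.fst ((equivTangentBundleProd I' M I N).symm (X, Y)) = X := by
  rw [tangentMap_prodFst]; rfl

/-- `T` of the second projection, on a pair of tangent vectors. -/
theorem tangentMap_snd_pair {N : Type*} [TopologicalSpace N] [ChartedSpace H N]
    (X : TangentBundle I' M) (Y : TangentBundle I N) :
    tangentMap (I'.prod I) I Prod.snd ((equivTangentBundleProd I' M I N).symm (X, Y)) = Y := by
  rw [tangentMap_prodSnd]; rfl

/-- The tangent bundle of a Lie group is a group. -/
instance tangentGroup : Group (TangentBundle I G) where
  mul_assoc X Y Z := by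
    let q := (equivTangentBundleProd I G I G).symm (Y, Z)
    let p := (equivTangentBundleProd I G (I.prod I) (G × G)).symm (X, q)
    have d1 : MDifferentiableAt (I.prod (I.prod I)) I (Prod.fst : G × (G × G) → G) p.1 :=
      mdifferentiableAt_fst
    have d2 : MDifferentiableAt (I.prod (I.prod I)) (I.prod I)
        (Prod.snd : G × (G × G) → G × G) p.1 := mdifferentiableAt_snd
    have d21 : MDifferentiableAt (I.prod (I.prod I)) I
        (fun x : G × (G × G) => x.2.1) p.1 := mdifferentiableAt_fst.comp _ d2
    have d22 : MDifferentiableAt (I.prod (I.prod I)) I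
        (fun x : G × (G × G) => x.2.2) p.1 := mdifferentiableAt_snd.comp _ d2
    have hq : tangentMap (I.prod (I.prod I)) (I.prod I) (Prod.snd : G × (G × G) → G × G) p = q :=
      tangentMap_snd_pair X q
    have e1 : tangentMap (I.prod (I.prod I)) I (Prod.fst : G × (G × G) → G) p = X :=
      tangentMap_fst_pair X q
    have e2 : tangentMap (I.prod (I.prod I)) I (fun x : G × (G × G) => x.2.1) p = Y := by
      have := tangentMap_comp_at (I := I.prod (I.prod I)) (I' := I.prod I) (I'' := I)
        (g := (Prod.fst : G × G → G)) (f := (Prod.snd : G × (G × G) → G × G)) p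
        mdifferentiableAt_fst d2
      refine this.trans ?_
      rw [hq]; exact tangentMap_fst_pair Y Z
    have e3 : tangentMap (I.prod (I.prod I)) I (fun x : G × (G × G) => x.2.2) p = Z := by
      have := tangentMap_comp_at (I := I.prod (I.prod I)) (I' := I.prod I) (I'' := I)
        (g := (Prod.snd : G × G → G)) (f := (Prod.snd : G × (G × G) → G × G)) p
        mdifferentiableAt_snd d2
      refine this.trans ?_
      rw [hq]; exact tangentMap_snd_pair Y Z
    have hm : MDifferentiable (I.prod I) I (fun q : G × G => q.1 * q.2) :=
      (contMDiff_mul I ∞ (G := G)).mdifferentiable (by simp)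
    have d12 : MDifferentiableAt (I.prod (I.prod I)) I
        (fun x : G × (G × G) => x.1 * x.2.1) p.1 :=
      (hm _).comp p.1 (d1.prodMk d21)
    have d23 : MDifferentiableAt (I.prod (I.prod I)) I
        (fun x : G × (G × G) => x.2.1 * x.2.2) p.1 :=
      (hm _).comp p.1 (d21.prodMk d22)
    have l := tangentMap_mul d12 d22
    have r := tangentMap_mul d1 d23
    rw [tangentMap_mul d1 d21, e1, e2, e3] at l
    rw [tangentMap_mul d21 d22, e1, e2, e3] at r
    rw [← l, ← r]
    simp only [mul_assoc]
  one_mul X := by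
    have h := tangentMap_mul (I := I) (I' := I) (f := fun _ : G => (1 : G)) (g := id) (p := X)
      mdifferentiableAt_const mdifferentiableAt_id
    rw [tangentMap_const_one, tangentMap_id] at h
    refine h.symm.trans ?_
    have : (fun x : G => 1 * id x) = id := by ext x; simp
    rw [this, tangentMap_id]; rfl
  mul_one X := by
    have h := tangentMap_mul (I := I) (I' := I) (f := id) (g := fun _ : G => (1 : G)) (p := X)
      mdifferentiableAt_id mdifferentiableAt_const
    rw [tangentMap_const_one, tangentMap_id] at h
    refine h.symm.trans ?_
    have : (fun x : G => id x * 1) = id := by ext x; simp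
    rw [this, tangentMap_id]; rfl
  inv_mul_cancel X := by
    have hi : MDifferentiableAt I I (fun a : G => a⁻¹) X.1 :=
      (contMDiff_inv I ∞ (G := G)).mdifferentiable (by simp) _
    have h := tangentMap_mul (I := I) (I' := I) (g := id) (p := X) hi mdifferentiableAt_id
    rw [tangentMap_id] at h
    refine h.symm.trans ?_
    have : (fun x : G => x⁻¹ * id x) = fun _ => 1 := by ext x; simp
    rw [this, tangentMap_const_one]

variable {G' : Type*} [TopologicalSpace G'] [ChartedSpace H' G'] [Group G'] [LieGroup I' ∞ G']

/-- The tangent map `Tγ : TG → TG'` of a homomorphism of Lie groups, as a group homomorphism. -/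
def tangentHom (γ : ContMDiffMonoidMorphism I I' ∞ G G') :
    TangentBundle I G →* TangentBundle I' G' :=
  MonoidHom.mk' (tangentMap I I' γ) (by
    intro X Y
    let q := (equivTangentBundleProd I G I G).symm (X, Y)
    have hγ : MDifferentiable I I' γ := γ.contMDiff_toFun.mdifferentiable (by simp)
    have hm : MDifferentiable (I.prod I) I (fun q : G × G => q.1 * q.2) :=
      (contMDiff_mul I ∞ (G := G)).mdifferentiable (by simp)
    have h1 := tangentMap_comp_at (I := I.prod I) (I' := I) (I'' := I') (g := γ)
      (f := (Prod.fst : G × G → G)) q (hγ _) mdifferentiableAt_fst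
    have h2 := tangentMap_comp_at (I := I.prod I) (I' := I) (I'' := I') (g := γ)
      (f := (Prod.snd : G × G → G)) q (hγ _) mdifferentiableAt_snd
    have h3 := tangentMap_comp_at (I := I.prod I) (I' := I) (I'' := I') (g := γ)
      (f := fun q : G × G => q.1 * q.2) q (hγ _) (hm _)
    rw [tangentMap_fst_pair] at h1
    rw [tangentMap_snd_pair] at h2
    refine h3.symm.trans ?_
    rw [← h1, ← h2, ← tangentMap_mul ((hγ _).comp _ mdifferentiableAt_fst)
      ((hγ _).comp _ mdifferentiableAt_snd)]
    congr 1
    ext x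
    exact map_mul γ x.1 x.2)

end TangentGroup

/-! ### The vector space `TV` of a finite-dimensional vector space `V` -/

section TangentVector

variable {V : Type*} [NormedAddCommGroup V] [NormedSpace ℝ V]

/-- `X ⊕ Y = (T τ_y) X + (T τ_x) Y` for `X ∈ T_x V` and `Y ∈ T_y V`, where `τ_a` is the translation
by `a`. -/
instance tangentAdd : Add (TangentBundle 𝓘(ℝ, V) V) where
  add X Y := ⟨X.1 + Y.1,
    (show TangentSpace 𝓘(ℝ, V) (X.1 + Y.1) from
      mfderiv 𝓘(ℝ, V) 𝓘(ℝ, V) (fun z : V => z + Y.1) X.1 X.2) +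
    (show TangentSpace 𝓘(ℝ, V) (X.1 + Y.1) from
      mfderiv 𝓘(ℝ, V) 𝓘(ℝ, V) (fun z : V => X.1 + z) Y.1 Y.2)⟩

/-- `c • X = (T σ_c) X`, where `σ_c` is the multiplication by `c`. -/
instance tangentSMul : SMul ℝ (TangentBundle 𝓘(ℝ, V) V) where
  smul c X := tangentMap 𝓘(ℝ, V) 𝓘(ℝ, V) (fun z : V => c • z) X

instance tangentZero : Zero (TangentBundle 𝓘(ℝ, V) V) where
  zero := ⟨0, (0 : TangentSpace 𝓘(ℝ, V) (0 : V))⟩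

instance tangentNeg : Neg (TangentBundle 𝓘(ℝ, V) V) where
  neg X := tangentMap 𝓘(ℝ, V) 𝓘(ℝ, V) (fun z : V => -z) X

/-- The pair of base point and velocity of a tangent vector of `V`. -/
def pair (X : TangentBundle 𝓘(ℝ, V) V) : V × V := (X.1, X.2)

theorem pair_injective : Function.Injective (pair (V := V)) := by
  rintro ⟨x, u⟩ ⟨y, v⟩ h
  obtain ⟨h1, h2⟩ := Prod.mk.inj h
  dsimp only at h1 h2
  subst h1
  congr 1

theorem mfderiv_vec {W : Type*} [NormedAddCommGroup W] [NormedSpace ℝ W] {f : V → W}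
    {L : V →L[ℝ] W} {p : V} (h : HasFDerivAt f L p) (v : V) :
    @Eq W (mfderiv 𝓘(ℝ, V) 𝓘(ℝ, W) f p v) (L v) := by
  rw [mfderiv_eq_fderiv, h.fderiv]
  rfl

theorem pair_add (X Y : TangentBundle 𝓘(ℝ, V) V) : pair (X + Y) = pair X + pair Y :=
  Prod.ext rfl (congrArg₂ (fun a b : V => a + b)
    (mfderiv_vec ((hasFDerivAt_id X.1).add_const Y.1) X.2)
    (mfderiv_vec ((hasFDerivAt_id Y.1).const_add X.1) Y.2))

theorem pair_smul (c : ℝ) (X : TangentBundle 𝓘(ℝ, V) V) : pair (c • X) = c • pair X :=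
  Prod.ext rfl (mfderiv_vec ((hasFDerivAt_id X.1).const_smul c) X.2)

theorem pair_neg (X : TangentBundle 𝓘(ℝ, V) V) : pair (-X) = -pair X :=
  Prod.ext rfl (mfderiv_vec (hasFDerivAt_id X.1).neg X.2)

theorem pair_zero : pair (0 : TangentBundle 𝓘(ℝ, V) V) = 0 := rfl

instance tangentAddCommGroup : AddCommGroup (TangentBundle 𝓘(ℝ, V) V) where
  add_assoc X Y Z := pair_injective (by simp only [pair_add, add_assoc])
  zero_add X := pair_injective (by simp only [pair_add, pair_zero, zero_add])
  add_zero X := pair_injective (by simp only [pair_add, pair_zero, add_zero])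
  nsmul := nsmulRec
  zsmul := zsmulRec
  neg_add_cancel X := pair_injective (by simp only [pair_add, pair_neg, pair_zero, neg_add_cancel])
  add_comm X Y := pair_injective (by simp only [pair_add, add_comm])

instance tangentModule : Module ℝ (TangentBundle 𝓘(ℝ, V) V) where
  one_smul X := pair_injective (by simp only [pair_smul, one_smul])
  mul_smul a b X := pair_injective (by simp only [pair_smul, mul_smul])
  smul_zero a := pair_injective (by simp only [pair_smul, pair_zero, smul_zero])
  smul_add a X Y := pair_injective (by simp only [pair_smul, pair_add, smul_add])
  add_smul a b X := pair_injective (by simp only [pair_smul, pair_add, add_smul])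
  zero_smul X := pair_injective (by simp only [pair_smul, pair_zero, zero_smul])

variable [FiniteDimensional ℝ V] {ι : Type*}

theorem mfderiv_coord (b : Module.Basis ι ℝ V) (i : ι) (p v : V) :
    @Eq ℝ (mfderiv 𝓘(ℝ, V) 𝓘(ℝ, ℝ) (fun z : V => b.repr z i) p v) (b.repr v i) :=
  mfderiv_vec (LinearMap.toContinuousLinearMap (b.coord i)).hasFDerivAt v

variable [Fintype ι]

/-- The bundle trivialization `ψ : TV → V × ℝⁿ` in the global coordinates `x_i` of a basis:
a tangent vector `∑ v_i ∂/∂x_i` at `p` goes to `(p, (v_i))`, where `v_i = dx_i(v)`. -/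
def trivialization (b : Module.Basis ι ℝ V) :
    TangentBundle 𝓘(ℝ, V) V ≃ₗ[ℝ] V × (ι → ℝ) where
  toFun X := (X.1, fun i => mfderiv 𝓘(ℝ, V) 𝓘(ℝ, ℝ) (fun z : V => b.repr z i) X.1 X.2)
  invFun q := ⟨q.1, (∑ i, q.2 i • b i : V)⟩
  map_add' X Y := by
    refine Prod.ext rfl (funext fun i => (mfderiv_coord b i (X + Y).1 (X + Y).2).trans ?_)
    refine Eq.trans ?_ (congrArg₂ (fun a b : ℝ => a + b)
      (mfderiv_coord b i X.1 X.2) (mfderiv_coord b i Y.1 Y.2)).symm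
    change b.repr (pair (X + Y)).2 i = b.repr (pair X).2 i + b.repr (pair Y).2 i
    rw [pair_add]; simp
  map_smul' c X := by
    refine Prod.ext rfl (funext fun i => (mfderiv_coord b i (c • X).1 (c • X).2).trans ?_)
    refine Eq.trans ?_ (congrArg (fun a : ℝ => c * a) (mfderiv_coord b i X.1 X.2)).symm
    change b.repr (pair (c • X)).2 i = c * b.repr (pair X).2 i
    rw [pair_smul]; simp
  left_inv X := by
    refine pair_injective (Prod.ext rfl ?_)
    refine Eq.trans (Finset.sum_congr rfl fun i _ =>
      congrArg (fun a : ℝ => a • b i) (mfderiv_coord b i X.1 X.2)) ?_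
    exact b.sum_repr _
  right_inv q := by
    refine Prod.ext rfl (funext fun i => (mfderiv_coord b i q.1 (∑ i, q.2 i • b i)).trans ?_)
    exact congrFun (b.repr_sum_self q.2) i

/-- The basis `α̃_i = ψ⁻¹(α_i, 0)`, `ỹ_i = ψ⁻¹(0, e_i)` of `TV`. -/
def tangentBasis (b : Module.Basis ι ℝ V) : Module.Basis (ι ⊕ ι) ℝ (TangentBundle 𝓘(ℝ, V) V) :=
  (b.prod (Pi.basisFun ℝ ι)).map (trivialization b).symm

end TangentVector

/-! ### The identification `T(V₁ ⊕ V₂) = TV₁ ⊕ TV₂` -/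

section TangentProd

variable {V₁ : Type*} [NormedAddCommGroup V₁] [NormedSpace ℝ V₁]
  {V₂ : Type*} [NormedAddCommGroup V₂] [NormedSpace ℝ V₂]

/-- The linear isomorphism `T(V₁ ⊕ V₂) → TV₁ ⊕ TV₂` given by the tangent maps of the projections.
Its inverse takes `X ∈ T_x V₁`, `Y ∈ T_y V₂` to `(T f_x) Y + (T f̄_y) X`, where `f_x z = (x, z)` and
`f̄_y z = (z, y)`. -/
def tangentProdEquiv : TangentBundle 𝓘(ℝ, V₁ × V₂) (V₁ × V₂) ≃ₗ[ℝ]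
    TangentBundle 𝓘(ℝ, V₁) V₁ × TangentBundle 𝓘(ℝ, V₂) V₂ where
  toFun W := (tangentMap 𝓘(ℝ, V₁ × V₂) 𝓘(ℝ, V₁) Prod.fst W,
    tangentMap 𝓘(ℝ, V₁ × V₂) 𝓘(ℝ, V₂) Prod.snd W)
  invFun q := ⟨(q.1.1, q.2.1),
    (show TangentSpace 𝓘(ℝ, V₁ × V₂) (q.1.1, q.2.1) from
      mfderiv 𝓘(ℝ, V₂) 𝓘(ℝ, V₁ × V₂) (fun z : V₂ => (q.1.1, z)) q.2.1 q.2.2) +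
    (show TangentSpace 𝓘(ℝ, V₁ × V₂) (q.1.1, q.2.1) from
      mfderiv 𝓘(ℝ, V₁) 𝓘(ℝ, V₁ × V₂) (fun z : V₁ => (z, q.2.1)) q.1.1 q.1.2)⟩
  map_add' W W' := by
    have h := congrArg Prod.snd (pair_add W W')
    refine Prod.ext (pair_injective (Eq.trans ?_ (pair_add _ _).symm))
      (pair_injective (Eq.trans ?_ (pair_add _ _).symm))
    · refine Prod.ext rfl ?_
      simp only [pair, tangentMap, mfderiv_eq_fderiv, fderiv_fst]
      exact congrArg Prod.fst h
    · refine Prod.ext rfl ?_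
      simp only [pair, tangentMap, mfderiv_eq_fderiv, fderiv_snd]
      exact congrArg Prod.snd h
  map_smul' c W := by
    have h := congrArg Prod.snd (pair_smul c W)
    refine Prod.ext (pair_injective (Eq.trans ?_ (pair_smul _ _).symm))
      (pair_injective (Eq.trans ?_ (pair_smul _ _).symm))
    · refine Prod.ext rfl ?_
      simp only [pair, tangentMap, mfderiv_eq_fderiv, fderiv_fst]
      exact congrArg Prod.fst h
    · refine Prod.ext rfl ?_
      simp only [pair, tangentMap, mfderiv_eq_fderiv, fderiv_snd]
      exact congrArg Prod.snd h
  left_inv W := by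
    refine pair_injective (Prod.ext rfl ?_)
    simp only [pair, tangentMap, mfderiv_eq_fderiv, fderiv_fst, fderiv_snd]
    rw [(hasFDerivAt_prodMk_left _ _).fderiv, (hasFDerivAt_prodMk_right _ _).fderiv]
    refine Prod.ext ?_ ?_
    · exact zero_add _
    · exact add_zero _
  right_inv q := by
    refine Prod.ext (pair_injective (Prod.ext rfl ?_)) (pair_injective (Prod.ext rfl ?_))
    · simp only [pair, tangentMap, mfderiv_eq_fderiv, fderiv_fst]
      rw [(hasFDerivAt_prodMk_left _ _).fderiv, (hasFDerivAt_prodMk_right _ _).fderiv]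
      exact zero_add _
    · simp only [pair, tangentMap, mfderiv_eq_fderiv, fderiv_snd]
      rw [(hasFDerivAt_prodMk_left _ _).fderiv, (hasFDerivAt_prodMk_right _ _).fderiv]
      exact add_zero _

end TangentProd

/-! ### The homomorphism `J_n : T GL(n, ℝ) → GL(2n, ℝ)` -/

section UnitsOfAlgebra

variable {R : Type*} [NormedRing R] [NormedAlgebra ℝ R] [CompleteSpace R]

/-- The element of the algebra `R` which a tangent vector of the open subset `Rˣ` of `R` is: its
image under the tangent map of the inclusion of `Rˣ` in `R`. -/
def velocity (Y : TangentBundle 𝓘(ℝ, R) Rˣ) : R :=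
  (tangentMap 𝓘(ℝ, R) 𝓘(ℝ, R) (Units.val : Rˣ → R) Y).2

theorem mdifferentiable_val : MDifferentiable 𝓘(ℝ, R) 𝓘(ℝ, R) (Units.val : Rˣ → R) :=
  (Units.contMDiff_val (n := ∞)).mdifferentiable (by simp)

theorem velocity_mul (X Y : TangentBundle 𝓘(ℝ, R) Rˣ) :
    velocity (X * Y) = velocity X * (Y.1 : R) + (X.1 : R) * velocity Y := by
  let q := (equivTangentBundleProd 𝓘(ℝ, R) Rˣ 𝓘(ℝ, R) Rˣ).symm (X, Y)
  have hm : MDifferentiable (𝓘(ℝ, R).prod 𝓘(ℝ, R)) 𝓘(ℝ, R) (fun q : Rˣ × Rˣ => q.1 * q.2) :=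
    (contMDiff_mul 𝓘(ℝ, R) ∞ (G := Rˣ)).mdifferentiable (by simp)
  have h1 : HasMFDerivAt (𝓘(ℝ, R).prod 𝓘(ℝ, R)) 𝓘(ℝ, R) (fun q : Rˣ × Rˣ => (q.1 : R)) q.1
      ((mfderiv 𝓘(ℝ, R) 𝓘(ℝ, R) (Units.val : Rˣ → R) X.1).comp
        (ContinuousLinearMap.fst ℝ R R)) :=
    HasMFDerivAt.comp (g := (Units.val : Rˣ → R)) q.1 (mdifferentiable_val X.1).hasMFDerivAt
      (hasMFDerivAt_fst q.1)
  have h2 : HasMFDerivAt (𝓘(ℝ, R).prod 𝓘(ℝ, R)) 𝓘(ℝ, R) (fun q : Rˣ × Rˣ => (q.2 : R)) q.1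
      ((mfderiv 𝓘(ℝ, R) 𝓘(ℝ, R) (Units.val : Rˣ → R) Y.1).comp
        (ContinuousLinearMap.snd ℝ R R)) :=
    HasMFDerivAt.comp (g := (Units.val : Rˣ → R)) q.1 (mdifferentiable_val Y.1).hasMFDerivAt
      (hasMFDerivAt_snd q.1)
  have h3 := (h1.mul' h2).mfderiv
  have h4 := tangentMap_comp_at (I := 𝓘(ℝ, R).prod 𝓘(ℝ, R)) (I' := 𝓘(ℝ, R)) (I'' := 𝓘(ℝ, R))
    (g := (Units.val : Rˣ → R)) (f := fun q : Rˣ × Rˣ => q.1 * q.2) q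
    (mdifferentiable_val _) (hm _)
  change (tangentMap 𝓘(ℝ, R) 𝓘(ℝ, R) (Units.val : Rˣ → R)
    (tangentMap (𝓘(ℝ, R).prod 𝓘(ℝ, R)) 𝓘(ℝ, R) (fun q : Rˣ × Rˣ => q.1 * q.2) q)).2 = _
  rw [← h4]
  refine (congrArg (fun L => L q.2) h3).trans ?_
  exact add_comm _ _

theorem velocity_rightTranslation (a : Rˣ) (Y : TangentBundle 𝓘(ℝ, R) Rˣ) :
    velocity (tangentMap 𝓘(ℝ, R) 𝓘(ℝ, R) (fun y : Rˣ => y * a) Y) = velocity Y * (a : R) := by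
  have h := tangentMap_mul (I := 𝓘(ℝ, R)) (I' := 𝓘(ℝ, R)) (f := (id : Rˣ → Rˣ))
    (g := fun _ : Rˣ => a) (p := Y) mdifferentiableAt_id mdifferentiableAt_const
  refine (congrArg velocity h).trans ?_
  rw [velocity_mul, tangentMap_id]
  have h0 : velocity (tangentMap 𝓘(ℝ, R) 𝓘(ℝ, R) (fun _ : Rˣ => a) Y) = 0 := by
    simp only [velocity, tangentMap, mfderiv_const]
    exact map_zero _
  rw [h0, mul_zero, add_zero]
  rfl

end UnitsOfAlgebra

section GeneralLinear

open scoped Matrix.Norms.Operator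

-- The topology of the space of matrices is read off its norm.
attribute [-instance] instTopologicalSpaceMatrix
attribute [-instance] Matrix.instUniformSpace

variable {ι : Type*} [Fintype ι] [DecidableEq ι]

instance completeSpace_matrix : CompleteSpace (Matrix ι ι ℝ) :=
  FiniteDimensional.complete ℝ (Matrix ι ι ℝ)

/-- The tangent bundle of `GL(n, ℝ)`. -/
abbrev TangentGL (ι : Type*) [Fintype ι] [DecidableEq ι] : Type _ :=
  TangentBundle 𝓘(ℝ, Matrix ι ι ℝ) (Matrix ι ι ℝ)ˣ

/-- The matrix `B = (T R_{a⁻¹}) Y` in the Lie algebra of `GL(n, ℝ)`, for `Y ∈ T_a GL(n, ℝ)`. -/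
def rightLog (Y : TangentGL ι) : Matrix ι ι ℝ :=
  velocity (tangentMap 𝓘(ℝ, Matrix ι ι ℝ) 𝓘(ℝ, Matrix ι ι ℝ)
    (fun y : (Matrix ι ι ℝ)ˣ => y * (Y.1)⁻¹) Y)

theorem rightLog_mul (Y : TangentGL ι) : rightLog Y * (Y.1 : Matrix ι ι ℝ) = velocity Y := by
  rw [rightLog, velocity_rightTranslation, mul_assoc, Units.inv_mul, mul_one]

/-- The block matrix with rows `(a, 0)` and `(B a, a)`, for `Y = [a, B]`. -/
def jMatrix (Y : TangentGL ι) : Matrix (ι ⊕ ι) (ι ⊕ ι) ℝ :=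
  Matrix.fromBlocks (Y.1 : Matrix ι ι ℝ) 0 (rightLog Y * (Y.1 : Matrix ι ι ℝ))
    (Y.1 : Matrix ι ι ℝ)

/-- The homomorphism `J_n : T GL(n, ℝ) → GL(2n, ℝ)`. -/
def jHom : TangentGL ι →* (Matrix (ι ⊕ ι) (ι ⊕ ι) ℝ)ˣ :=
  MonoidHom.toHomUnits
    { toFun := jMatrix
      map_one' := by
        have h : velocity (1 : TangentGL ι) = 0 := map_zero _
        rw [jMatrix, rightLog_mul, h]
        exact Matrix.fromBlocks_one
      map_mul' := fun X Y => by
        rw [jMatrix, jMatrix, jMatrix, rightLog_mul, rightLog_mul, rightLog_mul, velocity_mul,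
          Matrix.fromBlocks_multiply]
        simp only [zero_mul, mul_zero, add_zero, zero_add]
        rfl }

end GeneralLinear

/-! ### Representations and their prolongations -/

section Prolongation

variable {E : Type*} [NormedAddCommGroup E] [NormedSpace ℝ E] {H : Type*} [TopologicalSpace H]
  {I : ModelWithCorners ℝ E H} {G : Type*} [TopologicalSpace G] [ChartedSpace H G] [Group G]
  {V : Type*} [NormedAddCommGroup V] [NormedSpace ℝ V] [FiniteDimensional ℝ V]

instance completeSpace_endomorphisms : CompleteSpace (V →L[ℝ] V) :=
  FiniteDimensional.complete ℝ (V →L[ℝ] V)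

/-- A finite-dimensional real representation of the Lie group `G`: a homomorphism of Lie groups
(smooth homomorphism of groups) `G → Aut(V)`, where `Aut(V)` is the Lie group of the invertible
elements of the algebra of endomorphisms of `V`. -/
abbrev LieRep (I : ModelWithCorners ℝ E H) (G : Type*) [TopologicalSpace G] [ChartedSpace H G]
    [Group G] (V : Type*) [NormedAddCommGroup V] [NormedSpace ℝ V] [FiniteDimensional ℝ V] :
    Type _ :=
  ContMDiffMonoidMorphism I 𝓘(ℝ, V →L[ℝ] V) ∞ G (V →L[ℝ] V)ˣ

section Coordinates

open scoped Matrix.Norms.Operator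

-- The topology of the space of matrices is read off its norm.
attribute [-instance] instTopologicalSpaceMatrix
attribute [-instance] Matrix.instUniformSpace

variable {ι : Type*} [Fintype ι] [DecidableEq ι]

/-- The matrix of an endomorphism of `V` with respect to a basis, as a homomorphism of algebras. -/
def matrixHom (b : Module.Basis ι ℝ V) : (V →L[ℝ] V) →ₐ[ℝ] Matrix ι ι ℝ :=
  AlgHom.ofLinearMap
    ((LinearMap.toMatrixAlgEquiv b).toLinearMap ∘ₗ ContinuousLinearMap.coeLM ℝ)
    (map_one (LinearMap.toMatrixAlgEquiv b))
    (fun F F' => map_mul (LinearMap.toMatrixAlgEquiv b) (F : V →ₗ[ℝ] V) (F' : V →ₗ[ℝ] V))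

/-- The homomorphism of Lie groups `Z : Aut(V) → GL(n, ℝ)`, which takes `F` to its matrix. -/
def zHom (b : Module.Basis ι ℝ V) :
    ContMDiffMonoidMorphism 𝓘(ℝ, V →L[ℝ] V) 𝓘(ℝ, Matrix ι ι ℝ) ∞
      (V →L[ℝ] V)ˣ (Matrix ι ι ℝ)ˣ where
  toMonoidHom := Units.map (matrixHom b : (V →L[ℝ] V) →* Matrix ι ι ℝ)
  contMDiff_toFun := by
    apply ContMDiff.of_comp_isOpenEmbedding Units.isOpenEmbedding_val
    have h : ContDiff ℝ ∞ (matrixHom b) :=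
      (LinearMap.toContinuousLinearMap (matrixHom b).toLinearMap).contDiff
    exact h.contMDiff.comp Units.contMDiff_val

/-- The isomorphism `Z̆ : Aut(TV) → GL(2n, ℝ)`, which takes `F` to its matrix with respect to the
basis `α̃_1, …, α̃_n, ỹ_1, …, ỹ_n` of `TV`. -/
def zTangentEquiv (b : Module.Basis ι ℝ V) :
    LinearMap.GeneralLinearGroup ℝ (TangentBundle 𝓘(ℝ, V) V) ≃* (Matrix (ι ⊕ ι) (ι ⊕ ι) ℝ)ˣ :=
  Units.mapEquiv (LinearMap.toMatrixAlgEquiv (tangentBasis b)).toMulEquiv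

/-- The prolongation `Φ̃ = Z̆⁻¹ ∘ J_n ∘ TZ ∘ TΦ : TG → Aut(TV)` of a representation
`Φ : G → Aut(V)`, where the coordinates are those of the basis `b` of `V`. -/
def prolongation [LieGroup I ∞ G] (b : Module.Basis ι ℝ V) (Φ : LieRep I G V) :
    TangentBundle I G →* LinearMap.GeneralLinearGroup ℝ (TangentBundle 𝓘(ℝ, V) V) :=
  (zTangentEquiv b).symm.toMonoidHom.comp
    (jHom.comp ((tangentHom (zHom b)).comp (tangentHom Φ)))

end Coordinates

/-- The direct sum `ρ₁ ⊕ ρ₂ : K → Aut(W₁ ⊕ W₂)` of linear representations of an abstract group. -/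
def directSum {K W₁ W₂ : Type*} [Group K] [AddCommGroup W₁] [Module ℝ W₁] [AddCommGroup W₂]
    [Module ℝ W₂] (ρ₁ : K →* LinearMap.GeneralLinearGroup ℝ W₁)
    (ρ₂ : K →* LinearMap.GeneralLinearGroup ℝ W₂) :
    K →* LinearMap.GeneralLinearGroup ℝ (W₁ × W₂) :=
  MonoidHom.toHomUnits
    { toFun := fun k => LinearMap.prodMap (ρ₁ k : W₁ →ₗ[ℝ] W₁) (ρ₂ k : W₂ →ₗ[ℝ] W₂)
      map_one' := by rw [map_one, map_one]; rfl
      map_mul' := fun k l => by rw [map_mul, map_mul]; rfl }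

variable {V₁ : Type*} [NormedAddCommGroup V₁] [NormedSpace ℝ V₁] [FiniteDimensional ℝ V₁]
  {V₂ : Type*} [NormedAddCommGroup V₂] [NormedSpace ℝ V₂] [FiniteDimensional ℝ V₂]

/-- The direct sum `Φ₁ ⊕ Φ₂ : G → Aut(V₁ ⊕ V₂)` of representations of a Lie group. -/
def LieRep.directSum (Φ₁ : LieRep I G V₁) (Φ₂ : LieRep I G V₂) : LieRep I G (V₁ × V₂) where
  toMonoidHom := MonoidHom.toHomUnits
    { toFun := fun g =>
        ContinuousLinearMap.prodMap (Φ₁ g : V₁ →L[ℝ] V₁) (Φ₂ g : V₂ →L[ℝ] V₂)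
      map_one' := by rw [map_one, map_one]; rfl
      map_mul' := fun g h => by rw [map_mul, map_mul]; rfl }
  contMDiff_toFun := by
    apply ContMDiff.of_comp_isOpenEmbedding Units.isOpenEmbedding_val
    have h1 : ContMDiff I 𝓘(ℝ, V₁ →L[ℝ] V₁) ∞ (fun g : G => (Φ₁ g : V₁ →L[ℝ] V₁)) :=
      Units.contMDiff_val.comp Φ₁.contMDiff_toFun
    have h2 : ContMDiff I 𝓘(ℝ, V₂ →L[ℝ] V₂) ∞ (fun g : G => (Φ₂ g : V₂ →L[ℝ] V₂)) :=
      Units.contMDiff_val.comp Φ₂.contMDiff_toFun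
    exact (ContinuousLinearMap.prodMapL ℝ V₁ V₁ V₂ V₂).contDiff.contMDiff.comp (h1.prodMk_space h2)

end Prolongation

end LieProlongation

end

/-! The prolongation has a description free of coordinates. Identify `TV` with `V × V` by base point
and velocity (`pair`). For `Y ∈ T_a GL(n, ℝ)` the factor `a` in the block `B a` undoes the right
translation by `a⁻¹`, so `B a` is the velocity of `Y`, and `J_n (Y)` is the block matrix with rows
`(a, 0)` and `(velocity Y, a)`. Since `Z` is the restriction of a linear map, `TZ` takes the
velocity of an automorphism to the matrix of that velocity. Hence for `X ∈ T_g G` the prolongation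
sends `(p, v)` to `(Φ(g) p, dΦ(X) p + Φ(g) v)`; this is `pair_prolongation`.

No basis occurs in this formula, so the bases may be chosen independently of each other. For a
direct sum both `Φ(g)` and `dΦ(X)` are block diagonal (`LieRep.derivative_directSum`), and the
isomorphism `T(V₁ ⊕ V₂) → TV₁ ⊕ TV₂` only regroups `((p₁, p₂), (v₁, v₂))` as `((p₁, v₁), (p₂, v₂))`.
The formula therefore splits into its two components. -/

open scoped Manifold ContDiff

noncomputable section

namespace LieProlongation

/-! ### Velocities of maps into the units of an algebra -/

section Velocity

variable {R : Type*} [NormedRing R] [NormedAlgebra ℝ R] [CompleteSpace R]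
  {E : Type*} [NormedAddCommGroup E] [NormedSpace ℝ E] {H : Type*} [TopologicalSpace H]
  {I : ModelWithCorners ℝ E H} {M : Type*} [TopologicalSpace M] [ChartedSpace H M]

/-- The velocity of the image of a tangent vector under a map `f` into `Rˣ` is the derivative
of `f`, seen as a map into `R`. -/
theorem velocity_tangentMap {f : M → Rˣ} {X : TangentBundle I M}
    (hf : MDifferentiableAt I 𝓘(ℝ, R) f X.1) :
    velocity (tangentMap I 𝓘(ℝ, R) f X) =
      mfderiv I 𝓘(ℝ, R) (fun x => (f x : R)) X.1 X.2 :=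
  (congrArg (fun L => L X.2)
    (mfderiv_comp X.1 (mdifferentiable_val (f X.1)) hf)).symm

/-- A map into `Rˣ` which in `R` is a continuous linear function of a map `f`
has as velocity the value of this linear function on the derivative of `f`. -/
theorem velocity_tangentMap_of_linear {F : Type*} [NormedAddCommGroup F] [NormedSpace ℝ F]
    {f : M → Rˣ} {X : TangentBundle I M} (hf : MDifferentiableAt I 𝓘(ℝ, R) f X.1)
    (L : F →L[ℝ] R) {h : M → F} {D : E →L[ℝ] F}
    (hh : HasMFDerivAt I 𝓘(ℝ, F) h X.1 D) (hfh : ∀ x, (f x : R) = L (h x)) :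
    velocity (tangentMap I 𝓘(ℝ, R) f X) = L (D X.2) := by
  rw [velocity_tangentMap hf]
  have e : (fun x => (f x : R)) = L ∘ h := funext hfh
  rw [e]
  have := (HasMFDerivAt.comp X.1 (L.hasMFDerivAt (x := h X.1)) hh).mfderiv
  rw [this]
  rfl

end Velocity

/-! ### Tangent vectors of a vector space as pairs -/

section TangentVectors

variable {V : Type*} [NormedAddCommGroup V] [NormedSpace ℝ V]
  {V₁ : Type*} [NormedAddCommGroup V₁] [NormedSpace ℝ V₁]
  {V₂ : Type*} [NormedAddCommGroup V₂] [NormedSpace ℝ V₂]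

/-- A linear projection is its own derivative, so its tangent map projects base point and velocity
alike. -/
theorem pair_tangentProdEquiv_fst (W : TangentBundle 𝓘(ℝ, V₁ × V₂) (V₁ × V₂)) :
    pair (tangentProdEquiv W).1 = ((pair W).1.1, (pair W).2.1) :=
  Prod.ext rfl (mfderiv_vec (V := V₁ × V₂) hasFDerivAt_fst W.2)

theorem pair_tangentProdEquiv_snd (W : TangentBundle 𝓘(ℝ, V₁ × V₂) (V₁ × V₂)) :
    pair (tangentProdEquiv W).2 = ((pair W).1.2, (pair W).2.2) :=
  Prod.ext rfl (mfderiv_vec (V := V₁ × V₂) hasFDerivAt_snd W.2)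

/-- `pair` as a linear map. -/
def pairLinear : TangentBundle 𝓘(ℝ, V) V →ₗ[ℝ] V × V where
  toFun := pair
  map_add' := pair_add
  map_smul' := pair_smul

end TangentVectors

/-! ### The derivative of a representation -/

section Representations

variable {E : Type*} [NormedAddCommGroup E] [NormedSpace ℝ E] {H : Type*} [TopologicalSpace H]
  {I : ModelWithCorners ℝ E H} {G : Type*} [TopologicalSpace G] [ChartedSpace H G] [Group G]
  {V : Type*} [NormedAddCommGroup V] [NormedSpace ℝ V] [FiniteDimensional ℝ V]
  {V₁ : Type*} [NormedAddCommGroup V₁] [NormedSpace ℝ V₁] [FiniteDimensional ℝ V₁]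
  {V₂ : Type*} [NormedAddCommGroup V₂] [NormedSpace ℝ V₂] [FiniteDimensional ℝ V₂]

theorem LieRep.mdifferentiable (Φ : LieRep I G V) : MDifferentiable I 𝓘(ℝ, V →L[ℝ] V) Φ :=
  Φ.contMDiff_toFun.mdifferentiable (by simp)

/-- The endomorphism `dΦ(X)` of `V`, for a tangent vector `X` of `G`. -/
def LieRep.derivative (Φ : LieRep I G V) (X : TangentBundle I G) : V →L[ℝ] V :=
  velocity (tangentMap I 𝓘(ℝ, V →L[ℝ] V) Φ X)

/-- The block diagonal endomorphism depends linearly on its two blocks, so differentiation acts on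
each block separately. -/
theorem LieRep.derivative_directSum (Φ₁ : LieRep I G V₁) (Φ₂ : LieRep I G V₂)
    (X : TangentBundle I G) :
    (Φ₁.directSum Φ₂).derivative X =
      ContinuousLinearMap.prodMap (Φ₁.derivative X) (Φ₂.derivative X) := by
  have h1 := HasMFDerivAt.comp (g := (Units.val : (V₁ →L[ℝ] V₁)ˣ → _)) X.1
    (mdifferentiable_val (Φ₁ X.1)).hasMFDerivAt (Φ₁.mdifferentiable X.1).hasMFDerivAt
  have h2 := HasMFDerivAt.comp (g := (Units.val : (V₂ →L[ℝ] V₂)ˣ → _)) X.1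
    (mdifferentiable_val (Φ₂ X.1)).hasMFDerivAt (Φ₂.mdifferentiable X.1).hasMFDerivAt
  -- The target is a product of vector spaces regarded as one vector space, so the derivative of the
  -- pair is assembled by hand from its continuity and its derivative in charts.
  exact velocity_tangentMap_of_linear ((Φ₁.directSum Φ₂).mdifferentiable X.1)
    (ContinuousLinearMap.prodMapL ℝ V₁ V₁ V₂ V₂) ⟨h1.1.prodMk h2.1, h1.2.prodMk h2.2⟩ (fun _ => rfl)

/-! ### The prolongation in coordinates and its basis-free formula -/

section Coordinates

open scoped Matrix.Norms.Operator

attribute [-instance] instTopologicalSpaceMatrix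
attribute [-instance] Matrix.instUniformSpace

variable {ι : Type*} [Fintype ι]

/-- With its companion for `Sum.inr`, this shows that `tangentBasis b` corresponds to the basis of
`V × V` made of two copies of `b`, base points before velocities. -/
theorem pairLinear_tangentBasis_inl (b : Module.Basis ι ℝ V) (i : ι) :
    pairLinear (tangentBasis b (Sum.inl i)) = (b i, 0) := by
  have h : tangentBasis b (Sum.inl i) = (trivialization b).symm (b i, 0) := by
    simp [tangentBasis]
  rw [h]
  refine Prod.ext rfl ?_
  change ∑ j, (0 : ι → ℝ) j • b j = 0
  simp

theorem pairLinear_tangentBasis_inr [DecidableEq ι] (b : Module.Basis ι ℝ V) (i : ι) :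
    pairLinear (tangentBasis b (Sum.inr i)) = (0, b i) := by
  have h : tangentBasis b (Sum.inr i) = (trivialization b).symm (0, Pi.single i 1) := by
    simp [tangentBasis]
  rw [h]
  refine Prod.ext rfl ?_
  change ∑ j, (Pi.single i 1 : ι → ℝ) j • b j = b i
  simp [Pi.single_apply]

variable [DecidableEq ι]

/-- Matrices act on columns: column `i` holds the coordinates of the image of `b i`. -/
theorem sum_matrixHom_smul {V : Type*} [NormedAddCommGroup V] [NormedSpace ℝ V]
    (b : Module.Basis ι ℝ V) (F : V →L[ℝ] V) (i : ι) :
    ∑ j, matrixHom b F j i • b j = F (b i) := by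
  have h := Matrix.toLin_self b b (LinearMap.toMatrix b b (F : V →ₗ[ℝ] V)) i
  rw [Matrix.toLin_toMatrix] at h
  exact h.symm

/-- `Z` is the restriction to the units of the linear map `matrixHom b`, which is its own
derivative. -/
theorem velocity_zHom (b : Module.Basis ι ℝ V) (Y : TangentBundle 𝓘(ℝ, V →L[ℝ] V) (V →L[ℝ] V)ˣ) :
    velocity (tangentHom (zHom b) Y) = matrixHom b (velocity Y) :=
  velocity_tangentMap_of_linear (f := zHom b) (X := Y)
    ((zHom b).contMDiff_toFun.mdifferentiable (by simp) Y.1)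
    (LinearMap.toContinuousLinearMap (matrixHom b).toLinearMap)
    (mdifferentiable_val Y.1).hasMFDerivAt (fun _ => rfl)

/-- In terms of base points and velocities, the prolongation of `Φ` takes `(p, v)` to
`(Φ(g) p, dΦ(X) p + Φ(g) v)`, for `X ∈ T_g G`. -/
theorem pair_prolongation [LieGroup I ∞ G] (b : Module.Basis ι ℝ V) (Φ : LieRep I G V)
    (X : TangentBundle I G) (W : TangentBundle 𝓘(ℝ, V) V) :
    pair ((prolongation b Φ X : Module.End ℝ (TangentBundle 𝓘(ℝ, V) V)) W) =
      ((Φ X.1 : V →L[ℝ] V) (pair W).1,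
        Φ.derivative X (pair W).1 + (Φ X.1 : V →L[ℝ] V) (pair W).2) := by
  let a : V →ₗ[ℝ] V := (Φ X.1 : V →L[ℝ] V)
  let A : V →ₗ[ℝ] V := Φ.derivative X
  -- Both sides are linear in `W`, so it is enough to compare them on `tangentBasis b`.
  suffices h : pairLinear ∘ₗ (prolongation b Φ X : Module.End ℝ (TangentBundle 𝓘(ℝ, V) V)) =
      (a ∘ₗ LinearMap.fst ℝ V V).prod (A ∘ₗ LinearMap.fst ℝ V V + a ∘ₗ LinearMap.snd ℝ V V) ∘ₗ
        pairLinear from LinearMap.congr_fun h W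
  have hM : (prolongation b Φ X : Module.End ℝ (TangentBundle 𝓘(ℝ, V) V)) =
      Matrix.toLin (tangentBasis b) (tangentBasis b)
        (jMatrix (tangentHom (zHom b) (tangentHom Φ X))) := rfl
  have hJ : jMatrix (tangentHom (zHom b) (tangentHom Φ X)) =
      Matrix.fromBlocks (matrixHom b (Φ X.1)) 0 (matrixHom b (Φ.derivative X))
        (matrixHom b (Φ X.1)) := by
    -- `rightLog_mul` cancels the right translation against the factor `a`.
    rw [jMatrix, rightLog_mul, velocity_zHom]
    rfl
  rw [hM, hJ]
  refine (tangentBasis b).ext fun k => ?_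
  simp only [LinearMap.comp_apply, Matrix.toLin_self, Fintype.sum_sum_type]
  rcases k with i | i
  -- A left column consists of `a` above `B a`: the vector `(b i, 0)` goes to `(a (b i), A (b i))`.
  · have h1 := sum_matrixHom_smul b (Φ X.1 : V →L[ℝ] V) i
    have h2 := sum_matrixHom_smul b (Φ.derivative X) i
    ext <;> simp [pairLinear_tangentBasis_inl, pairLinear_tangentBasis_inr, Prod.fst_sum, Prod.snd_sum, h1, h2, a, A]
  -- A right column consists of `0` above `a`: the vector `(0, b i)` goes to `(0, a (b i))`.
  · have h1 := sum_matrixHom_smul b (Φ X.1 : V →L[ℝ] V) i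
    ext <;> simp [pairLinear_tangentBasis_inr, Prod.fst_sum, Prod.snd_sum, h1, a]

end Coordinates

end Representations

end LieProlongation

end

theorem corollary3p11
    {E : Type*} [NormedAddCommGroup E] [NormedSpace ℝ E]
    {H : Type*} [TopologicalSpace H] (I : ModelWithCorners ℝ E H)
    {G : Type*} [TopologicalSpace G] [ChartedSpace H G] [Group G] [LieGroup I ∞ G]
    {V₁ : Type*} [NormedAddCommGroup V₁] [NormedSpace ℝ V₁] [FiniteDimensional ℝ V₁]
    {V₂ : Type*} [NormedAddCommGroup V₂] [NormedSpace ℝ V₂] [FiniteDimensional ℝ V₂]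
    {ι₁ ι₂ ι : Type*} [Fintype ι₁] [DecidableEq ι₁] [Fintype ι₂] [DecidableEq ι₂]
    [Fintype ι] [DecidableEq ι]
    (b₁ : Module.Basis ι₁ ℝ V₁) (b₂ : Module.Basis ι₂ ℝ V₂) (b : Module.Basis ι ℝ (V₁ × V₂))
    (Φ₁ : LieProlongation.LieRep I G V₁) (Φ₂ : LieProlongation.LieRep I G V₂) :
    (LinearMap.GeneralLinearGroup.congrLinearEquiv
        (LieProlongation.tangentProdEquiv (V₁ := V₁) (V₂ := V₂))).toMonoidHom.comp
      (LieProlongation.prolongation b (LieProlongation.LieRep.directSum Φ₁ Φ₂)) =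
    LieProlongation.directSum (LieProlongation.prolongation b₁ Φ₁) (LieProlongation.prolongation b₂ Φ₂) := by
  open LieProlongation in
  refine MonoidHom.ext fun X => Units.ext (LinearMap.ext fun q => ?_)
  -- Writing `q` as the image of some `W` removes the inverse isomorphism from the conjugation.
  obtain ⟨W, rfl⟩ := (tangentProdEquiv (V₁ := V₁) (V₂ := V₂)).surjective q
  change tangentProdEquiv ((prolongation b (Φ₁.directSum Φ₂) X :
      Module.End ℝ (TangentBundle 𝓘(ℝ, V₁ × V₂) (V₁ × V₂)))
        (tangentProdEquiv.symm (tangentProdEquiv W))) =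
    ((prolongation b₁ Φ₁ X : Module.End ℝ (TangentBundle 𝓘(ℝ, V₁) V₁)) (tangentProdEquiv W).1,
      (prolongation b₂ Φ₂ X : Module.End ℝ (TangentBundle 𝓘(ℝ, V₂) V₂)) (tangentProdEquiv W).2)
  rw [LinearEquiv.symm_apply_apply]
  refine Prod.ext (pair_injective ?_) (pair_injective ?_)
  -- Once the basis-free formula is applied on both sides, what remains is the first component of
  -- block diagonal maps.
  · rw [pair_tangentProdEquiv_fst, pair_prolongation, pair_prolongation,
      pair_tangentProdEquiv_fst, LieRep.derivative_directSum]
    rfl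
  · rw [pair_tangentProdEquiv_snd, pair_prolongation, pair_prolongation,
      pair_tangentProdEquiv_snd, LieRep.derivative_directSum]
    rfl
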